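/- Let $a,b,c,d\ge 0$ with $a+b+c+d=1$, and let $u,v\ge 0$ satisfy $u^2\le ad$ and $v^2\le bc$. Consider the two-qubit X state, written in the basis $|00\rangle,|01\rangle,|10\rangle,|11\rangle$ (first label: qubit $A$, second label: qubit $B$), $$\rho^{AB}=\begin{pmatrix}a&0&0&u\\0&b&v&0\\0&v&c&0\\u&0&0&d\end{pmatrix}.$$ A POVM $M=\{M_i\}_{i=1}^n$ on $A$ ($M_i\ge 0$, $\sum_i M_i=\mathbb 1$, $n$ finite) induces the decomposition $\{p_i,\rho_i^B\}$ of $\rho^B=\mathrm{Tr}_A\,\rho^{AB}$, where $p_i=\mathrm{Tr}[(M_i\otimes\mathbb 1)\rho^{AB}]$ and $\rho^B_i=\mathrm{Tr}_A[(M_i\otimes\mathbb 1)\rho^{AB}]/p_i$ (outcomes with $p_i=0$ do not count). Its average entropy is $\sum_i p_iS(\rho_i^B)$, where $S(\rho)=-\mathrm{Tr}\,\rho\log_2\rho$. The decomposition is called optimal if its average entropy is the smallest one that any POVM on $A$ can induce. The horizontal (respectively vertical) decomposition is the one induced by the von Neumann measurement of $\sigma_x$ (respectively $\sigma_z$) on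 $A$, that is, by the POVM $\{(\mathbb 1\pm\sigma_x)/2\}$ (respectively $\{(\mathbb 1\pm\sigma_z)/2\}$). Then: (i) if $u+v\ge|\sqrt{ad}-\sqrt{bc}|$, the horizontal decomposition is optimal; (ii) if $(u+v)^2\le(a-b)(d-c)$, the vertical decomposition is optimal. -/

import Mathlib

open scoped Matrix Kronecker ComplexOrder

noncomputable section

namespace XDiscord

/-- Operators on one qubit. -/
abbrev Op1 := Matrix (Fin 2) (Fin 2) ℂ

/-- Operators on two qubits `A ⊗ B`; the index `(i, j)` is the product basis vector `|i⟩ ⊗ |j⟩`. -/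
abbrev Op2 := Matrix (Fin 2 × Fin 2) (Fin 2 × Fin 2) ℂ

/-- The two-qubit matrix in X form, in the lexicographically ordered basis `00, 01, 10, 11`. -/
def xState (a b c d u v : ℝ) : Op2 :=
  Matrix.reindex finProdFinEquiv.symm finProdFinEquiv.symm
    !![(a : ℂ), 0, 0, u;
       0, b, v, 0;
       0, v, c, 0;
       u, 0, 0, d]

/-- The partial trace over the first qubit. -/
def partialTraceA (R : Op2) : Op1 :=
  fun j j' => ∑ i, R (i, j) (i, j')

/-- The von Neumann entropy in bits, `-∑ λ log₂ λ` over the eigenvalues with multiplicity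
(it is only used for density matrices). -/
def entropy (σ : Op1) : ℝ :=
  open Classical in
  if h : σ.IsHermitian then (∑ i, Real.negMulLog (h.eigenvalues i)) / Real.log 2 else 0

/-- A generalized measurement (POVM) on one qubit with `n` outcomes. -/
structure POVM (n : ℕ) where
  effect : Fin n → Op1
  posSemidef : ∀ i, (effect i).PosSemidef
  sum_eq_one : ∑ i, effect i = 1

/-- A finite family of weighted one-qubit operators `{p_i, ρ_i}`. -/
structure Ensemble (n : ℕ) where
  prob : Fin n → ℝ
  state : Fin n → Op1

/-- The average entropy `∑ p_i S(ρ_i)` of an ensemble. -/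
def Ensemble.avgEntropy {n : ℕ} (E : Ensemble n) : ℝ :=
  ∑ i, E.prob i * entropy (E.state i)

/-- The decomposition of the reduced state of `B` induced by the measurement `M` on `A`:
`p_i = Tr[(M_i ⊗ 1) ρ]` and `ρ_i = Tr_A[(M_i ⊗ 1) ρ] / p_i`.
An outcome of probability zero contributes nothing to the average entropy. -/
def inducedDecomposition (ρ : Op2) {n : ℕ} (M : POVM n) : Ensemble n where
  prob i := ((M.effect i ⊗ₖ (1 : Op1)) * ρ).trace.re
  state i :=
    (((((M.effect i ⊗ₖ (1 : Op1)) * ρ).trace.re)⁻¹ : ℝ) : ℂ) •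
      partialTraceA ((M.effect i ⊗ₖ (1 : Op1)) * ρ)

/-- An ensemble is an optimal decomposition of the reduced state of `B` if some measurement on `A`
induces it and its average entropy is the least one that any POVM on `A`, with any finite number of
outcomes, can induce. -/
def IsOptimalDecomposition (ρ : Op2) {n : ℕ} (E : Ensemble n) : Prop :=
  (∃ M : POVM n, E = inducedDecomposition ρ M) ∧
    ∀ (m : ℕ) (N : POVM m), E.avgEntropy ≤ (inducedDecomposition ρ N).avgEntropy

theorem posSemidef_half_one_add {σ : Op1} (h : σ.IsHermitian) (h2 : σ * σ = 1) :
    ((1 / 2 : ℂ) • (1 + σ)).PosSemidef := by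
  have key : (1 / 2 : ℂ) • (1 + σ) = ((1 / 2 : ℂ) • (1 + σ))ᴴ * ((1 / 2 : ℂ) • (1 + σ)) := by
    have e : ((1 / 2 : ℂ) • (1 + σ))ᴴ = (1 / 2 : ℂ) • (1 + σ) := by
      rw [Matrix.conjTranspose_smul, Matrix.conjTranspose_add, h.eq]
      simp
    rw [e, Matrix.smul_mul, Matrix.mul_smul, add_mul, mul_add, mul_add, h2, smul_smul]
    ext i j
    simp
    ring
  rw [key]
  exact Matrix.posSemidef_conjTranspose_mul_self _

/-- The von Neumann measurement of an observable `σ` with `σ² = 1`, whose effects are the spectral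
projections `(1 ± σ) / 2`. -/
def observableMeasurement (σ : Op1) (h : σ.IsHermitian) (h2 : σ * σ = 1) : POVM 2 where
  effect := ![(1 / 2 : ℂ) • (1 + σ), (1 / 2 : ℂ) • (1 + -σ)]
  posSemidef := by
    intro i
    fin_cases i
    · exact posSemidef_half_one_add h h2
    · exact posSemidef_half_one_add h.neg (by simpa using h2)
  sum_eq_one := by
    rw [Fin.sum_univ_two]
    ext i j
    simp
    ring

/-- The Pauli matrix `σ_x`. -/
def pauliX : Op1 := !![0, 1; 1, 0]

/-- The Pauli matrix `σ_z`. -/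
def pauliZ : Op1 := !![1, 0; 0, -1]

theorem pauliX_isHermitian : pauliX.IsHermitian := by
  ext i j
  fin_cases i <;> fin_cases j <;> simp [pauliX]

theorem pauliX_mul_self : pauliX * pauliX = 1 := by
  ext i j
  fin_cases i <;> fin_cases j <;> simp [pauliX]

theorem pauliZ_isHermitian : pauliZ.IsHermitian := by
  ext i j
  fin_cases i <;> fin_cases j <;> simp [pauliZ]

theorem pauliZ_mul_self : pauliZ * pauliZ = 1 := by
  ext i j
  fin_cases i <;> fin_cases j <;> simp [pauliZ]

/-- The horizontal decomposition: the one induced by measuring `σ_x` on `A`. -/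
def horizontalDecomposition (ρ : Op2) : Ensemble 2 :=
  inducedDecomposition ρ (observableMeasurement pauliX pauliX_isHermitian pauliX_mul_self)

/-- The vertical decomposition: the one induced by measuring `σ_z` on `A`. -/
def verticalDecomposition (ρ : Op2) : Ensemble 2 :=
  inducedDecomposition ρ (observableMeasurement pauliZ pauliZ_isHermitian pauliZ_mul_self)

end XDiscord

end

open scoped Matrix Kronecker ComplexOrder

namespace XDiscord

/-! An effect with diagonal `(x, y)` and off-diagonal entry `z` satisfies `|z|² ≤ xy`, so the
unnormalised state it leaves on `B` has determinant at least `Q(x, y) = (xa + yc)(xb + yd) - (u +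
v)²xy` (`offDiag_le`). The entropy of a qubit increases with its determinant, so only the diagonals
matter, and these sum to `(1, 1)`.

(i) The entropy is convex and increasing in `C = 2√det` (`convexOn_binEntropy_sqrt`). The hypotheses
make `Q` positive semidefinite, so `√Q` is a seminorm (`exists_norm_sq_eq`). Jensen's inequality and
the triangle inequality bound the average entropy below by its value at `C = 2√Q(1, 1)`, which
measuring `σ_x` attains.

(ii) The entropy is concave and decreasing in the Bloch length `r = √(1 - 4 det)`. The hypothesis
bounds `r` by a weighted mean of the Bloch lengths of the two vertical states, so each outcome costs
at least the same mean of their entropies. -/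

/-! ### Binary entropy as a function of `C` and of the Bloch length -/

/-- The first term of the power series of `2 artanh w`, whose terms are all nonnegative. It gives
the sign of the second derivative below. -/
theorem two_mul_le_log_sub_log {w : ℝ} (h0 : 0 ≤ w) (h1 : w < 1) :
    2 * w ≤ Real.log (1 + w) - Real.log (1 - w) := by
  have h := Real.hasSum_log_sub_log_of_abs_lt_one (x := w) (by rwa [abs_of_nonneg h0])
  have := sum_le_hasSum {0} (fun k _ => by positivity) h
  simpa using this

/-- The entropy of a qubit, as a function of twice the square root of the determinant, is convex. -/
theorem convexOn_binEntropy_sqrt :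
    ConvexOn ℝ (Set.Icc 0 1) fun C : ℝ => Real.binEntropy ((1 - √(1 - C ^ 2)) / 2) := by
  have key : ∀ C ∈ Set.Ioo (0 : ℝ) 1, ∃ w, √(1 - C ^ 2) = w ∧ 0 < w ∧ w < 1 ∧ w ^ 2 = 1 - C ^ 2 ∧
      HasDerivAt (fun C : ℝ => √(1 - C ^ 2)) (-C / w) C := by
    rintro C ⟨h0, h1⟩
    have hp : 0 < 1 - C ^ 2 := by nlinarith
    refine ⟨_, rfl, Real.sqrt_pos.2 hp, ?_, Real.sq_sqrt hp.le, ?_⟩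
    · rw [Real.sqrt_lt' one_pos]
      nlinarith
    · have := ((hasDerivAt_pow 2 C).const_sub 1).sqrt hp.ne'
      convert this using 1
      simp only [Nat.cast_ofNat, Nat.add_one_sub_one, pow_one]
      field_simp
  -- With `w = √(1 - C²)` and `w' = -C / w`, the second derivative simplifies to `(log (1 + w) - log
  -- (1 - w) - 2w) / (2w³)`.
  refine convexOn_of_hasDerivWithinAt2_nonneg
    (f' := fun C => C / (2 * √(1 - C ^ 2)) *
      (Real.log (1 - (1 - √(1 - C ^ 2)) / 2) - Real.log ((1 - √(1 - C ^ 2)) / 2)))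
    (f'' := fun C => (Real.log (1 + √(1 - C ^ 2)) - Real.log (1 - √(1 - C ^ 2))
      - 2 * √(1 - C ^ 2)) / (2 * √(1 - C ^ 2) ^ 3)) (convex_Icc 0 1) ?_ ?_ ?_ ?_
  · exact (Real.binEntropy_continuous.comp (by fun_prop)).continuousOn
  · intro C hC
    rw [interior_Icc] at hC
    obtain ⟨w, hw, h0, h1, hsq, hd⟩ := key C hC
    have := (Real.hasDerivAt_binEntropy (p := (1 - √(1 - C ^ 2)) / 2) (by rw [hw]; linarith)
      (by rw [hw]; linarith)).comp C ((hd.const_sub 1).div_const 2)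
    refine (this.congr_deriv ?_).hasDerivWithinAt
    rw [hw]
    field_simp
  · intro C hC
    rw [interior_Icc] at hC
    obtain ⟨w, hw, h0, h1, hsq, hd⟩ := key C hC
    have hl := (hd.const_sub 1).div_const 2
    have e1 : 1 - (1 - √(1 - C ^ 2)) / 2 ≠ 0 := by rw [hw]; linarith
    have e2 : (1 - √(1 - C ^ 2)) / 2 ≠ 0 := by rw [hw]; linarith
    have := ((hasDerivAt_id C).div (hd.const_mul 2) (by rw [hw]; positivity)).mul
      (((hl.const_sub 1).log e1).sub (hl.log e2))
    refine (this.congr_deriv ?_).hasDerivWithinAt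
    have hC0 := hC.1
    have hm : 1 - w ≠ 0 := by linarith
    have hp : 1 + w ≠ 0 := by linarith
    have l1 : Real.log ((1 + w) / 2) = Real.log (1 + w) - Real.log 2 :=
      Real.log_div hp two_ne_zero
    have l2 : Real.log ((1 - w) / 2) = Real.log (1 - w) - Real.log 2 :=
      Real.log_div hm two_ne_zero
    have hm' : 1 - (1 - w) / 2 = (1 + w) / 2 := by ring
    have hC2 : C ^ 2 = (1 - w) * (1 + w) := by linarith
    simp only [id, hw, hm', l1, l2, Pi.div_apply, Pi.sub_apply]
    generalize Real.log (1 + w) = x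
    generalize Real.log (1 - w) = y
    field_simp
    simp only [hC2]
    ring
  · intro C hC
    rw [interior_Icc] at hC
    obtain ⟨w, hw, h0, h1, hsq, hd⟩ := key C hC
    simp only [hw]
    have := two_mul_le_log_sub_log h0.le h1
    exact div_nonneg (by linarith) (by positivity)

theorem binEntropy_half_antitoneOn :
    AntitoneOn (fun r : ℝ => Real.binEntropy ((1 - r) / 2)) (Set.Icc 0 1) := by
  intro r hr s hs h
  refine Real.binEntropy_strictMonoOn.monotoneOn ?_ ?_ (by linarith) <;>
    constructor <;> norm_num <;> linarith [hr.1, hr.2, hs.1, hs.2]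

theorem binEntropy_half_concaveOn :
    ConcaveOn ℝ (Set.Icc 0 1) (fun r : ℝ => Real.binEntropy ((1 - r) / 2)) := by
  refine ⟨convex_Icc 0 1, fun x hx y hy s t hs ht hst => ?_⟩
  have := Real.strictConcave_binEntropy.concaveOn.2 (x := (1 - x) / 2) (y := (1 - y) / 2)
    ⟨by linarith [hx.2], by linarith [hx.1]⟩ ⟨by linarith [hy.2], by linarith [hy.1]⟩ hs ht hst
  refine this.trans (le_of_eq ?_)
  congr 1
  simp only [smul_eq_mul]
  linear_combination (1 / 2) * hst

/-! ### Qubit entropy from the determinant; quadratic forms as squared norms -/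

/-- The eigenvalues are `l` and `1 - l`, so `1 - 4 det = (1 - 2l)²`; the symmetry of binary entropy
absorbs the sign of the root. -/
theorem entropy_eq {σ : Op1} (h : σ.IsHermitian) (ht : σ.trace = 1) :
    σ.det.re ≤ 1 / 4 ∧
      entropy σ = Real.binEntropy ((1 - √(1 - 4 * σ.det.re)) / 2) / Real.log 2 := by
  have h1 : h.eigenvalues 0 + h.eigenvalues 1 = 1 := by
    have := h.trace_eq_sum_eigenvalues
    rw [ht, Fin.sum_univ_two] at this
    apply Complex.ofReal_injective
    rw [Complex.ofReal_add, Complex.ofReal_one]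
    exact this.symm
  have h2 : σ.det.re = h.eigenvalues 0 * h.eigenvalues 1 := by
    have := h.det_eq_prod_eigenvalues
    rw [Fin.prod_univ_two] at this
    rw [this]
    simp
  have h3 : h.eigenvalues 1 = 1 - h.eigenvalues 0 := by linarith
  rw [entropy, dif_pos h, Fin.sum_univ_two, h2, h3, ← Real.binEntropy_eq_negMulLog_add_negMulLog_one_sub]
  generalize h.eigenvalues 0 = l
  refine ⟨by nlinarith [sq_nonneg (l - 1 / 2)], ?_⟩
  have e : 1 - 4 * (l * (1 - l)) = (1 - 2 * l) ^ 2 := by ring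
  rw [e, Real.sqrt_sq_eq_abs]
  rcases abs_cases (1 - 2 * l) with ⟨q, -⟩ | ⟨q, -⟩ <;> rw [q]
  · ring_nf
  · rw [← Real.binEntropy_one_sub]
    ring_nf

/-- A positive semidefinite binary quadratic form is the square of a norm of a linear function. -/
theorem exists_norm_sq_eq {A B G : ℝ} (hA : 0 ≤ A) (hG : 0 ≤ G) (hB : B ^ 2 ≤ A * G) :
    ∃ e f : ℂ, ∀ x y : ℝ, ‖x * e + y * f‖ ^ 2 = A * x ^ 2 + 2 * B * (x * y) + G * y ^ 2 := by
  rcases hA.eq_or_lt with rfl | hA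
  · have : B = 0 := by nlinarith
    subst this
    refine ⟨0, (√G : ℝ), fun x y => ?_⟩
    rw [← Complex.normSq_eq_norm_sq, Complex.normSq_apply]
    simp
    linear_combination y ^ 2 * Real.sq_sqrt hG
  · have hn : 0 ≤ G - B ^ 2 / A := by
      rw [sub_nonneg, div_le_iff₀ hA]; linarith
    -- Completing the square: the real part is `√A x + (B / √A) y`, and the imaginary part carries
    -- the remaining multiple of `y`.
    refine ⟨(√A : ℝ), ⟨B / √A, √(G - B ^ 2 / A)⟩, fun x y => ?_⟩
    have hs : 0 < √A := Real.sqrt_pos.2 hA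
    have hs2 := Real.sq_sqrt hA.le
    have hn2 := Real.sq_sqrt hn
    rw [← Complex.normSq_eq_norm_sq, Complex.normSq_apply]
    simp
    have e : B ^ 2 / A = (B / √A) ^ 2 := by rw [div_pow, hs2]
    have e' : B / √A * √A = B := div_mul_cancel₀ _ hs.ne'
    rw [e] at hn2 ⊢
    linear_combination x ^ 2 * hs2 + y ^ 2 * hn2 + 2 * x * y * e'

/-! ### Outcomes of a measurement on an X state -/

theorem partialTraceA_xState (a b c d u v : ℝ) (M : Op1) :
    partialTraceA ((M ⊗ₖ (1 : Op1)) * xState a b c d u v) =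
      !![M 0 0 * a + M 1 1 * c, M 1 0 * u + M 0 1 * v;
         M 0 1 * u + M 1 0 * v, M 0 0 * b + M 1 1 * d] := by
  ext i j
  fin_cases i <;> fin_cases j <;>
    simp [partialTraceA, Matrix.mul_apply, xState, Fintype.sum_prod_type, Fin.sum_univ_two,
      finProdFinEquiv, Matrix.one_apply] <;> ring

theorem trace_eq_trace_partialTraceA (R : Op2) : R.trace = (partialTraceA R).trace := by
  simp [Matrix.trace, partialTraceA, Fintype.sum_prod_type, Fin.sum_univ_two]
  ring


/-- The determinant of the unnormalised state of `B` that the effect `M` on `A` leaves behind. -/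
noncomputable def outcomeDet (a b c d u v : ℝ) (M : Op1) : ℝ :=
  ((M 0 0).re * a + (M 1 1).re * c) * ((M 0 0).re * b + (M 1 1).re * d) -
    ‖M 1 0 * u + M 0 1 * v‖ ^ 2

theorem PosSemidef.entries {M : Op1} (h : M.PosSemidef) :
    0 ≤ (M 0 0).re ∧ 0 ≤ (M 1 1).re ∧ M 0 0 = ((M 0 0).re : ℂ) ∧ M 1 1 = ((M 1 1).re : ℂ) ∧
      M 1 0 = star (M 0 1) ∧ ‖M 0 1‖ ^ 2 ≤ (M 0 0).re * (M 1 1).re := by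
  have h0 := h.diag_nonneg (i := 0)
  have h1 := h.diag_nonneg (i := 1)
  have h10 : M 1 0 = star (M 0 1) := (h.isHermitian.apply 1 0).symm
  rw [Complex.nonneg_iff] at h0 h1
  have e0 : M 0 0 = ((M 0 0).re : ℂ) := Complex.ext rfl (by simpa using h0.2.symm)
  have e1 : M 1 1 = ((M 1 1).re : ℂ) := Complex.ext rfl (by simpa using h1.2.symm)
  refine ⟨h0.1, h1.1, e0, e1, h10, ?_⟩
  have hd := (Complex.nonneg_iff.1 h.det_nonneg).1
  rw [Matrix.det_fin_two, h10, e0, e1] at hd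
  rw [← Complex.normSq_eq_norm_sq, Complex.normSq_apply]
  simp at hd
  linarith

theorem offDiag_le {M : Op1} (h : M.PosSemidef) {u v : ℝ} (hu : 0 ≤ u) (hv : 0 ≤ v) :
    ‖M 1 0 * u + M 0 1 * v‖ ^ 2 ≤ (u + v) ^ 2 * ((M 0 0).re * (M 1 1).re) := by
  obtain ⟨-, -, -, -, h10, hle⟩ := PosSemidef.entries h
  have : ‖M 1 0 * u + M 0 1 * v‖ ≤ (u + v) * ‖M 0 1‖ := by
    refine (norm_add_le _ _).trans (le_of_eq ?_)
    rw [norm_mul, norm_mul, h10, norm_star, Complex.norm_of_nonneg hu, Complex.norm_of_nonneg hv]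
    ring
  calc _ ≤ ((u + v) * ‖M 0 1‖) ^ 2 := by gcongr
    _ = (u + v) ^ 2 * ‖M 0 1‖ ^ 2 := by ring
    _ ≤ _ := by gcongr

variable {a b c d u v : ℝ} {n : ℕ}

theorem prob_eq (N : POVM n) (i : Fin n) :
    (inducedDecomposition (xState a b c d u v) N).prob i =
      (N.effect i 0 0).re * (a + b) + (N.effect i 1 1).re * (c + d) := by
  simp only [inducedDecomposition]
  rw [trace_eq_trace_partialTraceA, partialTraceA_xState, Matrix.trace_fin_two]
  simp
  ring

theorem state_entropy_eq (N : POVM n) (i : Fin n) {p : ℝ}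
    (hp : (inducedDecomposition (xState a b c d u v) N).prob i = p) (h0 : p ≠ 0) :
    outcomeDet a b c d u v (N.effect i) / p ^ 2 ≤ 1 / 4 ∧
    entropy ((inducedDecomposition (xState a b c d u v) N).state i) =
      Real.binEntropy ((1 - √(1 - 4 * (outcomeDet a b c d u v (N.effect i) / p ^ 2))) / 2) /
        Real.log 2 := by
  have hs : (inducedDecomposition (xState a b c d u v) N).state i = ((p⁻¹ : ℝ) : ℂ) •
      partialTraceA ((N.effect i ⊗ₖ (1 : Op1)) * xState a b c d u v) := by
    rw [← hp]; rfl
  rw [prob_eq] at hp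
  obtain ⟨-, -, e0, e1, h10, -⟩ := PosSemidef.entries (N.posSemidef i)
  rw [hs, partialTraceA_xState, outcomeDet]
  generalize N.effect i = M at *
  generalize (M 0 0).re = x at *
  generalize (M 1 1).re = y at *
  rw [e0, e1, h10]
  generalize M 0 1 = z
  set σ : Op1 := !![(x : ℂ) * a + y * c, star z * u + z * v; z * u + star z * v, x * b + y * d]
    with hσ
  have herm : (((p⁻¹ : ℝ) : ℂ) • σ).IsHermitian := by
    ext i j
    fin_cases i <;> fin_cases j <;> simp [hσ]
  have ht : (((p⁻¹ : ℝ) : ℂ) • σ).trace = 1 := by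
    rw [Matrix.trace_smul, Matrix.trace_fin_two, hσ]
    have : (p : ℂ) ≠ 0 := by exact_mod_cast h0
    simp
    rw [inv_mul_eq_one₀ this, ← hp]
    push_cast
    ring
  have hd : (((p⁻¹ : ℝ) : ℂ) • σ).det.re =
      ((x * a + y * c) * (x * b + y * d) - ‖star z * u + z * v‖ ^ 2) / p ^ 2 := by
    rw [Matrix.det_smul, Matrix.det_fin_two, hσ, ← Complex.normSq_eq_norm_sq,
      Complex.normSq_apply, Fintype.card_fin, ← Complex.ofReal_pow, Complex.re_ofReal_mul]
    simp
    field_simp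
    ring
  rw [← hd]
  exact entropy_eq herm ht

theorem sum_effect_re (N : POVM n) (j : Fin 2) : ∑ i, (N.effect i j j).re = 1 := by
  have := congrFun (congrFun N.sum_eq_one j) j
  rw [Matrix.sum_apply, Matrix.one_apply_eq] at this
  rw [← Complex.re_sum, this, Complex.one_re]

/-! ### The vertical decomposition -/

theorem vertical_avgEntropy_le (ha : 0 ≤ a) (hb : 0 ≤ b) (hc : 0 ≤ c) (hd : 0 ≤ d)
    (hu : 0 ≤ u) (hv : 0 ≤ v) (h : (u + v) ^ 2 ≤ (a - b) * (d - c)) (N : POVM n) :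
    (a + b) * (Real.binEntropy ((1 - |a - b| / (a + b)) / 2) / Real.log 2) +
      (c + d) * (Real.binEntropy ((1 - |d - c| / (c + d)) / 2) / Real.log 2) ≤
    (inducedDecomposition (xState a b c d u v) N).avgEntropy := by
  have hl : 0 < Real.log 2 := Real.log_pos one_lt_two
  set E₁ := Real.binEntropy ((1 - |a - b| / (a + b)) / 2) with hE₁
  set E₂ := Real.binEntropy ((1 - |d - c| / (c + d)) / 2) with hE₂
  have r₁ : |a - b| ≤ a + b := abs_le.2 ⟨by linarith, by linarith⟩
  have r₂ : |d - c| ≤ c + d := abs_le.2 ⟨by linarith, by linarith⟩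
  have m₁ : |a - b| / (a + b) ∈ Set.Icc (0 : ℝ) 1 :=
    ⟨by positivity, div_le_one_of_le₀ r₁ (by positivity)⟩
  have m₂ : |d - c| / (c + d) ∈ Set.Icc (0 : ℝ) 1 :=
    ⟨by positivity, div_le_one_of_le₀ r₂ (by positivity)⟩
  have key : ∀ i, (N.effect i 0 0).re * ((a + b) * (E₁ / Real.log 2)) +
      (N.effect i 1 1).re * ((c + d) * (E₂ / Real.log 2)) ≤
      (inducedDecomposition (xState a b c d u v) N).prob i *
        entropy ((inducedDecomposition (xState a b c d u v) N).state i) := by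
    intro i
    obtain ⟨hx, hy, -, -, -, -⟩ := PosSemidef.entries (N.posSemidef i)
    have ho := offDiag_le (N.posSemidef i) hu hv
    obtain ⟨p, hp⟩ : ∃ p, (inducedDecomposition (xState a b c d u v) N).prob i = p := ⟨_, rfl⟩
    have hpe := prob_eq (a := a) (b := b) (c := c) (d := d) (u := u) (v := v) N i
    rw [hp] at hpe ⊢
    have hxs : 0 ≤ (N.effect i 0 0).re * (a + b) := by positivity
    have hys : 0 ≤ (N.effect i 1 1).re * (c + d) := by positivity
    rcases eq_or_ne p 0 with h0 | h0
    · have z1 : (N.effect i 0 0).re * (a + b) = 0 := by linarith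
      have z2 : (N.effect i 1 1).re * (c + d) = 0 := by linarith
      rw [← mul_assoc, ← mul_assoc, z1, z2, h0]
      simp
    have hp0 : 0 < p := lt_of_le_of_ne (by linarith) h0.symm
    obtain ⟨hle, hent⟩ := state_entropy_eq N i hp h0
    rw [hent]
    rw [outcomeDet] at hle ⊢
    generalize (N.effect i 0 0).re = x at *
    generalize (N.effect i 1 1).re = y at *
    generalize ‖N.effect i 1 0 * u + N.effect i 0 1 * v‖ ^ 2 = o at *
    have hmix := binEntropy_half_concaveOn.2 m₁ m₂ (div_nonneg hxs hp0.le)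
      (div_nonneg hys hp0.le) (by rw [← add_div, ← hpe, div_self h0])
    have hmem := binEntropy_half_concaveOn.1 m₁ m₂ (div_nonneg hxs hp0.le)
      (div_nonneg hys hp0.le) (by rw [← add_div, ← hpe, div_self h0])
    set r := (x * (a + b) / p) • (|a - b| / (a + b)) + (y * (c + d) / p) • (|d - c| / (c + d))
      with hr
    have hre : r = (x * |a - b| + y * |d - c|) / p := by
      -- If `a + b = 0`, the quotient is `0` by convention, and `|a - b| ≤ a + b` vanishes too.
      have q₁ : (a + b) * (|a - b| / (a + b)) = |a - b| := by
        rcases (add_nonneg ha hb).eq_or_lt with q | q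
        · rw [← q] at r₁ ⊢
          linarith [abs_nonneg (a - b)]
        · field_simp
      have q₂ : (c + d) * (|d - c| / (c + d)) = |d - c| := by
        rcases (add_nonneg hc hd).eq_or_lt with q | q
        · rw [← q] at r₂ ⊢
          linarith [abs_nonneg (d - c)]
        · field_simp
      rw [hr, smul_eq_mul, smul_eq_mul]
      linear_combination (x / p) * q₁ + (y / p) * q₂
    -- Times `p²`, the left side is `(x(a - b) - y(d - c))² + 4o`. Since `o ≤ (a - b)(d - c)xy`, the
    -- added term at most flips the sign of the cross term.
    have hsq : 1 - 4 * (((x * a + y * c) * (x * b + y * d) - o) / p ^ 2) ≤ r ^ 2 := by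
      have habs : |a - b| * |d - c| = (a - b) * (d - c) := by
        rw [← abs_mul, abs_of_nonneg ((sq_nonneg _).trans h)]
      have hxy : (u + v) ^ 2 * (x * y) ≤ (a - b) * (d - c) * (x * y) := by gcongr
      rw [hre, div_pow, le_div_iff₀ (by positivity), sub_mul, one_mul, mul_assoc,
        div_mul_cancel₀ _ (by positivity), hpe]
      have hexp : (x * |a - b| + y * |d - c|) ^ 2 =
          x ^ 2 * (a - b) ^ 2 + y ^ 2 * (d - c) ^ 2 + 2 * (x * y) * ((a - b) * (d - c)) := by
        linear_combination x ^ 2 * sq_abs (a - b) + y ^ 2 * sq_abs (d - c) + 2 * (x * y) * habs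
      rw [hexp]
      linarith
    have hrle : √(1 - 4 * (((x * a + y * c) * (x * b + y * d) - o) / p ^ 2)) ≤ r :=
      Real.sqrt_le_iff.2 ⟨hmem.1, hsq⟩
    have hmono := binEntropy_half_antitoneOn ⟨Real.sqrt_nonneg _, hrle.trans hmem.2⟩ hmem hrle
    have hfin := hmix.trans hmono
    simp only [smul_eq_mul] at hfin
    rw [← hE₁, ← hE₂] at hfin
    calc x * ((a + b) * (E₁ / Real.log 2)) + y * ((c + d) * (E₂ / Real.log 2))
        = p * ((x * (a + b) / p * E₁ + y * (c + d) / p * E₂) / Real.log 2) := by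
          field_simp
      _ ≤ _ := by gcongr
  calc _ = ∑ i, ((N.effect i 0 0).re * ((a + b) * (E₁ / Real.log 2)) +
      (N.effect i 1 1).re * ((c + d) * (E₂ / Real.log 2))) := by
        rw [Finset.sum_add_distrib, ← Finset.sum_mul, ← Finset.sum_mul, sum_effect_re,
          sum_effect_re, one_mul, one_mul]
    _ ≤ _ := Finset.sum_le_sum fun i _ => key i

theorem verticalDecomposition_avgEntropy (ha : 0 ≤ a) (hb : 0 ≤ b) (hc : 0 ≤ c) (hd : 0 ≤ d) :
    (verticalDecomposition (xState a b c d u v)).avgEntropy =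
    (a + b) * (Real.binEntropy ((1 - |a - b| / (a + b)) / 2) / Real.log 2) +
      (c + d) * (Real.binEntropy ((1 - |d - c| / (c + d)) / 2) / Real.log 2) := by
  rw [verticalDecomposition, Ensemble.avgEntropy, Fin.sum_univ_two]
  set N := observableMeasurement pauliZ pauliZ_isHermitian pauliZ_mul_self with hN
  have p0 : (inducedDecomposition (xState a b c d u v) N).prob 0 = a + b := by
    rw [prob_eq]; simp [hN, observableMeasurement, pauliZ]; norm_num
  have p1 : (inducedDecomposition (xState a b c d u v) N).prob 1 = c + d := by
    rw [prob_eq]; simp [hN, observableMeasurement, pauliZ]; norm_num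
  have d0 : outcomeDet a b c d u v (N.effect 0) = a * b := by
    simp [outcomeDet, hN, observableMeasurement, pauliZ]; norm_num
  have d1 : outcomeDet a b c d u v (N.effect 1) = c * d := by
    simp [outcomeDet, hN, observableMeasurement, pauliZ]; norm_num
  have aux : ∀ s t : ℝ, 0 ≤ s → 0 ≤ t → s + t ≠ 0 →
      √(1 - 4 * (s * t / (s + t) ^ 2)) = |s - t| / (s + t) := by
    intro s t hs ht h
    have : 1 - 4 * (s * t / (s + t) ^ 2) = ((s - t) / (s + t)) ^ 2 := by
      field_simp
      ring
    rw [this, Real.sqrt_sq_eq_abs, abs_div, abs_of_nonneg (add_nonneg hs ht)]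
  rw [p0, p1]
  congr 1
  · by_cases h : a + b = 0
    · rw [h, zero_mul, zero_mul]
    · rw [(state_entropy_eq N 0 p0 h).2, d0, aux a b ha hb h]
  · by_cases h : c + d = 0
    · rw [h, zero_mul, zero_mul]
    · rw [(state_entropy_eq N 1 p1 h).2, d1, aux c d hc hd h, abs_sub_comm]

/-! ### The horizontal decomposition -/

theorem horizontalDecomposition_avgEntropy (htr : a + b + c + d = 1) :
    (horizontalDecomposition (xState a b c d u v)).avgEntropy =
      Real.binEntropy ((1 - √(1 - 4 * ((a + c) * (b + d) - (u + v) ^ 2))) / 2) / Real.log 2 := by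
  rw [horizontalDecomposition, Ensemble.avgEntropy, Fin.sum_univ_two]
  set N := observableMeasurement pauliX pauliX_isHermitian pauliX_mul_self with hN
  have p0 : (inducedDecomposition (xState a b c d u v) N).prob 0 = 1 / 2 := by
    rw [prob_eq]; simp [hN, observableMeasurement, pauliX]; linarith
  have p1 : (inducedDecomposition (xState a b c d u v) N).prob 1 = 1 / 2 := by
    rw [prob_eq]; simp [hN, observableMeasurement, pauliX]; linarith
  have hn : ∀ s : ℂ, s ^ 2 = 1 / 4 → ‖s * u + s * v‖ ^ 2 = (u + v) ^ 2 / 4 := by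
    intro s hs
    rw [← mul_add, norm_mul, mul_pow, ← norm_pow, hs, ← Complex.ofReal_add, Complex.norm_real,
      Real.norm_eq_abs, sq_abs]
    norm_num
    ring
  have d0 : outcomeDet a b c d u v (N.effect 0) = ((a + c) * (b + d) - (u + v) ^ 2) / 4 := by
    have := hn 2⁻¹ (by norm_num)
    simp [outcomeDet, hN, observableMeasurement, pauliX, this]; ring
  have d1 : outcomeDet a b c d u v (N.effect 1) = ((a + c) * (b + d) - (u + v) ^ 2) / 4 := by
    have := hn (-2⁻¹) (by norm_num)
    simp [outcomeDet, hN, observableMeasurement, pauliX] at this ⊢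
    rw [this]; ring
  rw [p0, p1, (state_entropy_eq N 0 p0 (by norm_num)).2,
    (state_entropy_eq N 1 p1 (by norm_num)).2, d0, d1]
  have e : ((a + c) * (b + d) - (u + v) ^ 2) / 4 / (1 / 2) ^ 2 =
    (a + c) * (b + d) - (u + v) ^ 2 := by ring
  rw [e]
  ring

theorem horizontal_avgEntropy_le (ha : 0 ≤ a) (hb : 0 ≤ b) (hc : 0 ≤ c) (hd : 0 ≤ d)
    (htr : a + b + c + d = 1) (hu : 0 ≤ u) (hv : 0 ≤ v) (hu2 : u ^ 2 ≤ a * d)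
    (hv2 : v ^ 2 ≤ b * c) (h : |√(a * d) - √(b * c)| ≤ u + v) (N : POVM n) :
    Real.binEntropy ((1 - √(1 - 4 * ((a + c) * (b + d) - (u + v) ^ 2))) / 2) / Real.log 2 ≤
      (inducedDecomposition (xState a b c d u v) N).avgEntropy := by
  have hl : 0 < Real.log 2 := Real.log_pos one_lt_two
  obtain ⟨e, f, hef⟩ : ∃ e f : ℂ, ∀ x y : ℝ, ‖x * e + y * f‖ ^ 2 =
      (a * b) * x ^ 2 + 2 * ((a * d + b * c - (u + v) ^ 2) / 2) * (x * y) + (c * d) * y ^ 2 := by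
    refine exists_norm_sq_eq (by positivity) (by positivity) ?_
    -- The discriminant condition is `|ad + bc - (u + v)²| ≤ 2√(ad)√(bc)`, that is, `u + v` lies
    -- between `|√(ad) - √(bc)|` and `√(ad) + √(bc)`. The hypothesis `h` gives the lower bound,
    -- positivity of the state the upper one.
    have s1 := Real.sq_sqrt (mul_nonneg ha hd)
    have s2 := Real.sq_sqrt (mul_nonneg hb hc)
    have t1 := Real.sqrt_nonneg (a * d)
    have t2 := Real.sqrt_nonneg (b * c)
    have hu' : u ≤ √(a * d) := Real.le_sqrt_of_sq_le hu2
    have hv' : v ≤ √(b * c) := Real.le_sqrt_of_sq_le hv2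
    have up : (u + v) ^ 2 ≤ (√(a * d) + √(b * c)) ^ 2 := by gcongr
    have lo : (√(a * d) - √(b * c)) ^ 2 ≤ (u + v) ^ 2 := by
      rw [← sq_abs]; gcongr
    have e : a * b * (c * d) = (√(a * d) * √(b * c)) ^ 2 := by
      rw [mul_pow, s1, s2]; ring
    rw [e]
    refine sq_le_sq' ?_ ?_ <;> nlinarith
  set g : ℝ → ℝ := fun C => Real.binEntropy ((1 - √(1 - C ^ 2)) / 2) with hg
  set C : Fin n → ℝ := fun i => 2 * ‖((N.effect i 0 0).re : ℂ) * e + ((N.effect i 1 1).re : ℂ) * f‖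
    with hC
  set P := (inducedDecomposition (xState a b c d u v) N).prob with hP
  have hg_mono : MonotoneOn g (Set.Icc 0 1) := by
    intro x hx y hy hxy
    refine binEntropy_half_antitoneOn ⟨Real.sqrt_nonneg _, ?_⟩ ⟨Real.sqrt_nonneg _, ?_⟩ ?_
    · exact Real.sqrt_le_one.2 (by nlinarith [sq_nonneg y])
    · exact Real.sqrt_le_one.2 (by nlinarith [sq_nonneg x])
    · exact Real.sqrt_le_sqrt (by nlinarith [hx.1])
  have hP0 : ∀ i, 0 ≤ P i := by
    intro i
    obtain ⟨hx, hy, -⟩ := PosSemidef.entries (N.posSemidef i)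
    rw [hP, prob_eq]
    positivity
  have hP1 : ∑ i, P i = 1 := by
    simp only [hP, prob_eq]
    rw [Finset.sum_add_distrib, ← Finset.sum_mul, ← Finset.sum_mul, sum_effect_re, sum_effect_re]
    linarith
  have hC0 : ∀ i, 0 ≤ C i := fun i => by positivity
  have hform : ∀ x y : ℝ, ‖x * e + y * f‖ ^ 2 =
      (x * a + y * c) * (x * b + y * d) - (u + v) ^ 2 * (x * y) := by
    intro x y; rw [hef]; ring
  have hCP : ∀ i, C i ≤ P i := by
    intro i
    obtain ⟨hx, hy, -⟩ := PosSemidef.entries (N.posSemidef i)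
    refine le_of_sq_le_sq ?_ (hP0 i)
    rw [hC, hP, prob_eq, mul_pow, hform]
    generalize (N.effect i 0 0).re = x at *
    generalize (N.effect i 1 1).re = y at *
    have : 0 ≤ (u + v) ^ 2 * (x * y) := by positivity
    -- AM-GM on the two diagonal entries of the unnormalised state, whose sum is `P i`.
    nlinarith [sq_nonneg ((x * a + y * c) - (x * b + y * d))]
  have hmem : ∀ i, C i / P i ∈ Set.Icc (0 : ℝ) 1 := fun i =>
    ⟨div_nonneg (hC0 i) (hP0 i), div_le_one_of_le₀ (hCP i) (hP0 i)⟩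
  have key : ∀ i, P i * (g (C i / P i) / Real.log 2) ≤
      P i * entropy ((inducedDecomposition (xState a b c d u v) N).state i) := by
    intro i
    rcases eq_or_ne (P i) 0 with h0 | h0
    · simp [h0]
    have hp0 : 0 < P i := lt_of_le_of_ne (hP0 i) h0.symm
    obtain ⟨hle, hent⟩ := state_entropy_eq N i (p := P i) rfl h0
    rw [hent]
    have ho := offDiag_le (N.posSemidef i) hu hv
    have hC2 : (C i / P i) ^ 2 ≤ 4 * (outcomeDet a b c d u v (N.effect i) / P i ^ 2) := by
      rw [div_pow, ← mul_div_assoc]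
      gcongr
      rw [hC, mul_pow, hform, outcomeDet]
      linarith
    have hs : √(1 - 4 * (outcomeDet a b c d u v (N.effect i) / P i ^ 2)) ≤
        √(1 - (C i / P i) ^ 2) := Real.sqrt_le_sqrt (by linarith)
    have h1 : √(1 - (C i / P i) ^ 2) ≤ 1 := Real.sqrt_le_one.2 (by nlinarith [sq_nonneg (C i / P i)])
    gcongr
    exact binEntropy_half_antitoneOn ⟨Real.sqrt_nonneg _, hs.trans h1⟩ ⟨Real.sqrt_nonneg _, h1⟩ hs
  have hjensen := convexOn_binEntropy_sqrt.map_sum_le (t := Finset.univ) (w := P)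
    (p := fun i => C i / P i) (fun i _ => hP0 i) hP1 (fun i _ => hmem i)
  have hsum : ∑ i, P i • (C i / P i) = ∑ i, C i := by
    refine Finset.sum_congr rfl fun i _ => ?_
    -- An outcome of probability zero has `C i = 0`, so dropping it loses nothing.
    rcases eq_or_ne (P i) 0 with h0 | h0
    · have := hCP i
      rw [h0] at this ⊢
      rw [zero_smul]
      exact (hC0 i).antisymm this |>.symm ▸ rfl
    · rw [smul_eq_mul, mul_div_cancel₀ _ h0]
  have hconv : ∑ i, P i • (C i / P i) ∈ Set.Icc (0 : ℝ) 1 := by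
    rw [hsum]
    exact ⟨Finset.sum_nonneg fun i _ => hC0 i, (Finset.sum_le_sum fun i _ => hCP i).trans hP1.le⟩
  -- Triangle inequality: the vectors inside the norms add up to `e + f` because both diagonals of
  -- the effects sum to `1`.
  have htri : 2 * ‖e + f‖ ≤ ∑ i, C i := by
    rw [hC, ← Finset.mul_sum]
    gcongr
    refine le_trans (le_of_eq ?_) (norm_sum_le _ _)
    rw [Finset.sum_add_distrib, ← Finset.sum_mul, ← Finset.sum_mul, ← Complex.ofReal_sum,
      ← Complex.ofReal_sum, sum_effect_re, sum_effect_re]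
    simp
  rw [hsum] at hconv hjensen
  have hlow : g (2 * ‖e + f‖) ≤ g (∑ i, C i) :=
    hg_mono ⟨by positivity, htri.trans hconv.2⟩ hconv htri
  have h11 : 1 - 4 * ((a + c) * (b + d) - (u + v) ^ 2) = 1 - (2 * ‖e + f‖) ^ 2 := by
    have := hform 1 1
    simp only [Complex.ofReal_one, one_mul, mul_one] at this
    rw [mul_pow, this]
    ring
  rw [h11]
  calc g (2 * ‖e + f‖) / Real.log 2 ≤ (∑ i, P i • g (C i / P i)) / Real.log 2 := by
        gcongr
        exact hlow.trans hjensen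
    _ = ∑ i, P i * (g (C i / P i) / Real.log 2) := by
        rw [Finset.sum_div]
        exact Finset.sum_congr rfl fun i _ => by rw [smul_eq_mul, mul_div_assoc]
    _ ≤ _ := Finset.sum_le_sum fun i _ => key i

end XDiscord

theorem corollary1 (a b c d u v : ℝ)
    (ha : 0 ≤ a) (hb : 0 ≤ b) (hc : 0 ≤ c) (hd : 0 ≤ d) (htr : a + b + c + d = 1)
    (hu : 0 ≤ u) (hv : 0 ≤ v) (hu2 : u ^ 2 ≤ a * d) (hv2 : v ^ 2 ≤ b * c) :
    (|Real.sqrt (a * d) - Real.sqrt (b * c)| ≤ u + v →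
      XDiscord.IsOptimalDecomposition (XDiscord.xState a b c d u v)
        (XDiscord.horizontalDecomposition (XDiscord.xState a b c d u v))) ∧
    ((u + v) ^ 2 ≤ (a - b) * (d - c) →
      XDiscord.IsOptimalDecomposition (XDiscord.xState a b c d u v)
        (XDiscord.verticalDecomposition (XDiscord.xState a b c d u v))) := by
  refine ⟨fun h => ⟨⟨_, rfl⟩, fun m N => ?_⟩, fun h => ⟨⟨_, rfl⟩, fun m N => ?_⟩⟩
  · rw [XDiscord.horizontalDecomposition_avgEntropy htr]
    exact XDiscord.horizontal_avgEntropy_le ha hb hc hd htr hu hv hu2 hv2 h N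
  · rw [XDiscord.verticalDecomposition_avgEntropy ha hb hc hd]
    exact XDiscord.vertical_avgEntropy_le ha hb hc hd hu hv h N
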